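/- Let $p$ be an odd prime and let $D_{2p}=\langle \tau,\sigma\mid \tau^p=\sigma^2=e,\ \sigma\tau\sigma=\tau^{-1}\rangle$ be the dihedral group of order $2p$. For a finite group $G$ and a subset $S\subseteq G$ with $1\notin S$ and $S^{-1}=S$, the Cayley graph $\mathrm{Cay}(G,S)$ is the graph with vertex set $G$ in which $g$ and $h$ are adjacent if and only if $hg^{-1}\in S$; a circulant graph of order $p$ is a Cayley graph on the cyclic group of order $p$. Put $$\mathcal N'=\frac1p\left(2^{\frac{p+1}{2}}-2^{\frac{3p-1}{2}}\right)+\frac{2}{p-1}\sum_{i=0}^{p-2}2^{\frac{\gcd(2i,p-1)}{2}+\gcd(i,p-1)},\qquad \mathcal N_c'=\frac{2}{p-1}\sum_{d\mid\frac{p-1}{2}}\varphi(d)\,2^{\frac{p-1}{2d}},$$ where $\varphi$ is Euler's totient function and $\gcd(0,p-1)=p-1$. Then the number of connected Cayley graphs on $D_{2p}$ up to graph isomorphism is equal to $$\mathcal N_1'=\mathcal N'-\mathcal N_c'-1.$$ Moreover, $\mathcal N'$ is the number of all Cayley graphs on $D_{2p}$ up to isomorphism, and $\mathcal N_c'$ is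 the number of circulant graphs of order $p$ up to isomorphism. -/

import Mathlib

/-- The Cayley graph `Cay(G, S)` of a group `G` with respect to a symmetric subset `S` that does
not contain the identity: the vertices are the elements of `G`, and `g`, `h` are adjacent iff
`h * g⁻¹ ∈ S`. -/
def cayleyGraph {G : Type*} [Group G] (S : Set G) (hone : (1 : G) ∉ S) (hsymm : S⁻¹ = S) :
    SimpleGraph G where
  Adj g h := h * g⁻¹ ∈ S
  symm := ⟨fun g h hgh => by
    rw [← hsymm, Set.mem_inv]
    simpa using hgh⟩
  loopless := ⟨fun g hg => hone (by simpa using hg)⟩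

/-- A graph on the vertex set `G` is a Cayley graph on the group `G` if it equals `Cay(G, S)` for
some admissible `S`. -/
def IsCayleyGraph {G : Type*} [Group G] (Γ : SimpleGraph G) : Prop :=
  ∃ (S : Set G) (hone : (1 : G) ∉ S) (hsymm : S⁻¹ = S), Γ = cayleyGraph S hone hsymm

/-- Graph isomorphism, as an equivalence relation on the graphs with vertex set `V`. -/
def graphIsoSetoid (V : Type*) : Setoid (SimpleGraph V) where
  r Γ Δ := Nonempty (Γ ≃g Δ)
  iseqv :=
    { refl := fun _ => ⟨RelIso.refl _⟩
      symm := fun ⟨e⟩ => ⟨e.symm⟩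
      trans := fun ⟨e⟩ ⟨f⟩ => ⟨e.trans f⟩ }

/-- The number, up to isomorphism, of the graphs with vertex set `V` that satisfy `P`. -/
noncomputable def numUpToIso {V : Type*} (P : SimpleGraph V → Prop) : ℕ :=
  Nat.card (Quotient ((graphIsoSetoid V).comap (Subtype.val : {Γ : SimpleGraph V // P Γ} → _)))

/-- The number of Cayley graphs on `G` up to isomorphism. -/
noncomputable def numCayleyGraphs (G : Type*) [Group G] : ℕ :=
  numUpToIso (fun Γ : SimpleGraph G => IsCayleyGraph Γ)

/-- The number of connected Cayley graphs on `G` up to isomorphism. -/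
noncomputable def numConnectedCayleyGraphs (G : Type*) [Group G] : ℕ :=
  numUpToIso (fun Γ : SimpleGraph G => IsCayleyGraph Γ ∧ Γ.Connected)

/-- The number of circulant graphs of order `n` up to isomorphism, that is, of Cayley graphs on the
cyclic group of order `n` (written multiplicatively). -/
noncomputable def numCirculantGraphs (n : ℕ) : ℕ :=
  numCayleyGraphs (Multiplicative (ZMod n))

/-- The number `N'`. For odd `p` all divisions in the exponents are exact. -/
def dihedralCount (p : ℕ) : ℚ :=
  1 / (p : ℚ) * (2 ^ ((p + 1) / 2) - 2 ^ ((3 * p - 1) / 2)) +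
    2 / ((p : ℚ) - 1) *
      ∑ i ∈ Finset.range (p - 1), 2 ^ (Nat.gcd (2 * i) (p - 1) / 2 + Nat.gcd i (p - 1))

/-- The number `N'_c`. For odd `p` all divisions in the exponents are exact. -/
def circulantCount (p : ℕ) : ℚ :=
  2 / ((p : ℚ) - 1) *
    ∑ d ∈ Nat.divisors ((p - 1) / 2), (Nat.totient d : ℚ) * 2 ^ ((p - 1) / (2 * d))

/-! A Cayley graph on the dihedral group amounts to a pair: a rotation part, closed under sign and
avoiding 0, hence a subset of `UnitsModNeg p`, and a reflection part, an arbitrary subset of `ZMod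
p` because reflections are involutions. The crux is that two pairs give isomorphic graphs exactly
when some x ↦ mx + c carries one to the other, with m alone acting on the rotation part
(`IsDihedralRel.exists_affine_of_iso`).

Right multiplication t by the generating rotation is an automorphism of order p of every such graph.
If ⟨t⟩ is a Sylow subgroup of the automorphism group of the target, any isomorphism can be corrected
to normalise ⟨t⟩, and is then affine on both cosets of the rotations. Otherwise t commutes with a
further automorphism, which forces the reflection part to be empty or everything. The graph is then
two disjoint copies of a circulant, or the complement of such a graph, and the same Sylow argument
on `ZMod p` (`exists_multiplier_of_circulant_iso`) finishes.

Isomorphism classes are therefore orbits, counted by Burnside: the affine group on pairs yields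
`dihedralCount`, the cyclic group `UnitsModNeg p` on its own subsets yields `circulantCount`. A
disconnected graph either has empty reflection part, with one class for each class of circulants, or
is a perfect matching, which is one more class. -/

open DihedralGroup
open scoped Pointwise

/-! ### Sylow theory and isomorphisms that normalise ⟨t⟩ -/

/-- In a finite group, two elements of order an odd prime `p` are either conjugate up to powers, or
the first one commutes with an element whose square is not one of its powers. -/
theorem exists_conj_eq_pow_or_exists_commute {G : Type*} [Group G] [Finite G] {p : ℕ}
    [hp : Fact p.Prime] (hodd : Odd p) {t u : G} (ht : orderOf t = p) (hu : orderOf u = p) :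
    (∃ (a : G) (m : ℕ), a * u * a⁻¹ = t ^ m) ∨
      ∃ s : G, Commute s t ∧ s ^ 2 ∉ Subgroup.zpowers t := by
  have isP : ∀ v : G, orderOf v = p → IsPGroup p (Subgroup.zpowers v) := fun v hv =>
    IsPGroup.of_card (n := 1) (by rw [Nat.card_zpowers, hv, pow_one])
  obtain ⟨P, hP⟩ := (isP t ht).exists_le_sylow
  obtain ⟨Q, hQ⟩ := (isP u hu).exists_le_sylow
  obtain ⟨a, ha⟩ := MulAction.exists_smul_eq G Q P
  have htP : t ∈ P := hP (Subgroup.mem_zpowers t)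
  have huP : a * u * a⁻¹ ∈ P := by
    rw [← ha]
    exact Subgroup.smul_mem_pointwise_smul u (MulAut.conj a) _ (hQ (Subgroup.mem_zpowers u))
  by_cases hle : (P : Subgroup G) ≤ Subgroup.zpowers t
  · left
    obtain ⟨m, hm⟩ := (mem_powers_iff_mem_zpowers (x := t)).2 (hle huP)
    exact ⟨a, m, hm.symm⟩
  right
  suffices h : ∃ s ∈ P, Commute s t ∧ s ∉ Subgroup.zpowers t by
    obtain ⟨s, hsP, hc, hs⟩ := h
    refine ⟨s, hc, fun h2 => hs ?_⟩
    obtain ⟨k, hk⟩ := P.isPGroup' ⟨s, hsP⟩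
    have hk' : s ^ p ^ k = 1 := by simpa [Subtype.ext_iff] using hk
    obtain ⟨l, hl⟩ := hodd.pow (n := k)
    -- The order of `s` divides `p ^ k = 2 * l + 1`, so `s` is a power of its square.
    have : s = ((s ^ 2) ^ l)⁻¹ := by
      rw [eq_inv_iff_mul_eq_one, ← pow_mul, ← pow_succ', ← hl, hk']
    rw [this]
    exact inv_mem (pow_mem h2 l)
  obtain ⟨s, hsP, hs⟩ := SetLike.not_le_iff_exists.1 hle
  have ht1 : t ≠ 1 := fun h => hp.out.one_lt.ne' (by rw [← ht, h, orderOf_one])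
  have : Nontrivial (P : Subgroup G) := ⟨⟨⟨t, htP⟩, 1, fun h => ht1 (congrArg Subtype.val h)⟩⟩
  have := P.isPGroup'.center_nontrivial
  obtain ⟨⟨⟨z, hzP⟩, hzc⟩, hz1⟩ := exists_ne (1 : Subgroup.center (P : Subgroup G))
  have hzc' : ∀ x ∈ P, x * z = z * x := fun x hx =>
    congrArg Subtype.val (Subgroup.mem_center_iff.1 hzc ⟨x, hx⟩)
  -- If the central element `z` lies in ⟨t⟩ it generates it, so `t` is central in `P` and any
  -- element of `P` outside ⟨t⟩ serves; otherwise `z` itself does.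
  by_cases hzt : z ∈ Subgroup.zpowers t
  · refine ⟨s, hsP, ?_, hs⟩
    obtain ⟨k, hk⟩ := (mem_powers_iff_mem_zpowers (x := t)).2 hzt
    have hk : t ^ k = z := hk
    have hz1' : z ≠ 1 := fun h => hz1 (by ext; exact h)
    have hcop : Nat.Coprime k (orderOf t) := by
      rw [ht, Nat.coprime_comm, hp.out.coprime_iff_not_dvd, ← ht, orderOf_dvd_iff_pow_eq_one, hk]
      exact hz1'
    obtain ⟨j, hj⟩ := exists_pow_eq_self_of_coprime hcop
    rw [hk] at hj
    rw [← hj]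
    exact Commute.pow_right (hzc' s hsP) j
  · exact ⟨z, hzP, (hzc' t htP).symm, hzt⟩

/-- The permutations that preserve a relation. -/
def relAutSubgroup {V : Type*} (r : V → V → Prop) : Subgroup (Equiv.Perm V) where
  carrier := {π | ∀ x y, r (π x) (π y) ↔ r x y}
  mul_mem' ha hb x y := (ha _ _).trans (hb x y)
  one_mem' _ _ := Iff.rfl
  inv_mem' {π} h x y := by
    rw [← h]; simp

/-- An isomorphism between two relations that admit an automorphism `t` of order `p` can be chosen
to normalise `⟨t⟩`, unless `t` commutes with an automorphism whose square is not in `⟨t⟩`. -/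
theorem exists_iso_normalizing_or_exists_commute {V : Type*} [Finite V] {p : ℕ} [Fact p.Prime]
    (hodd : Odd p) {r r' : V → V → Prop} {e : Equiv.Perm V} (he : ∀ x y, r' (e x) (e y) ↔ r x y)
    {t : Equiv.Perm V} (ht : orderOf t = p) (htr : t ∈ relAutSubgroup r)
    (htr' : t ∈ relAutSubgroup r') :
    (∃ (h : Equiv.Perm V) (m : ℕ), (∀ x y, r' (h x) (h y) ↔ r x y) ∧
        ∀ x, h (t x) = (t ^ m) (h x)) ∨
      ∃ s ∈ relAutSubgroup r', Commute s t ∧ s ^ 2 ∉ Subgroup.zpowers t := by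
  have hu : e * t * e⁻¹ ∈ relAutSubgroup r' := fun x y => by
    have h2 := he (e⁻¹ x) (e⁻¹ y)
    have hx : ∀ x, e (e⁻¹ x) = x := e.apply_symm_apply
    rw [hx, hx] at h2
    exact (he _ _).trans ((htr _ _).trans h2.symm)
  have hou : orderOf (e * t * e⁻¹) = p := by
    rw [← ht]
    exact orderOf_injective (MulAut.conj e).toMonoidHom (MulAut.conj e).injective t
  rcases exists_conj_eq_pow_or_exists_commute (G := relAutSubgroup r') hodd (t := ⟨t, htr'⟩)
    (u := ⟨_, hu⟩) (by simpa using ht) (by simpa using hou) with ⟨a, m, h⟩ | ⟨s, hc, hs⟩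
  · left
    refine ⟨e.trans a.1, m, fun x y => (a.2 _ _).trans (he x y), fun x => ?_⟩
    have h' := congrArg Subtype.val (mul_inv_eq_iff_eq_mul.1 h)
    simpa using DFunLike.congr_fun h' (e x)
  · right
    refine ⟨s.1, s.2, congrArg Subtype.val hc, fun h => hs ?_⟩
    obtain ⟨k, hk⟩ := h
    exact ⟨k, Subtype.ext (by simpa using hk)⟩

/-! ### Isomorphisms of circulants of prime order -/

/-- The multiples of a nonzero `d` exhaust `ZMod p`. This gives affine formulas, the triviality of
translation-invariant sets, and connectivity. -/
theorem ZMod.induction_add_of_ne_zero {p : ℕ} [Fact p.Prime] {P : ZMod p → Prop} {d : ZMod p}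
    (hd : d ≠ 0) (h0 : P 0) (hstep : ∀ i, P i → P (i + d)) (i : ZMod p) : P i := by
  have h : ∀ n : ℕ, P (n * d) := fun n => by
    induction n with
    | zero => simpa using h0
    | succ n ih => simpa [add_mul] using hstep _ ih
  have := h (i / d).val
  rwa [ZMod.natCast_zmod_val, div_mul_cancel₀ _ hd] at this

theorem addRight_one_pow_apply {p : ℕ} (m : ℕ) (x : ZMod p) :
    ((Equiv.addRight (1 : ZMod p)) ^ m) x = x + m := by
  induction m with
  | zero => simp
  | succ m ih => rw [pow_succ', Equiv.Perm.mul_apply, ih]; simp [add_assoc]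

theorem orderOf_addRight_one {p : ℕ} [hp : Fact p.Prime] :
    orderOf (Equiv.addRight (1 : ZMod p)) = p := by
  refine orderOf_eq_prime ?_ ?_
  · ext x; simp
  · intro h
    simpa using DFunLike.congr_fun h 0

/-- **Turner's theorem**: isomorphic circulants of odd prime order are related by a multiplier. -/
theorem exists_multiplier_of_circulant_iso {p : ℕ} [hp : Fact p.Prime] (hodd : Odd p)
    {S S' : Set (ZMod p)} {e : Equiv.Perm (ZMod p)} (he : ∀ x y, e y - e x ∈ S' ↔ y - x ∈ S) :
    ∃ m : ZMod p, m ≠ 0 ∧ ∀ x, m * x ∈ S' ↔ x ∈ S := by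
  have key : ∀ T : Set (ZMod p),
      Equiv.addRight (1 : ZMod p) ∈ relAutSubgroup (fun x y => y - x ∈ T) := fun T x y => by simp
  rcases exists_iso_normalizing_or_exists_commute hodd (r := fun x y => y - x ∈ S)
    (r' := fun x y => y - x ∈ S') he orderOf_addRight_one (key S) (key S') with
    ⟨h, m, hh, hm⟩ | ⟨s, -, hc, hs⟩
  · have haff : ∀ x, h x = h 0 + m * x := by
      refine ZMod.induction_add_of_ne_zero one_ne_zero (by simp) fun i hi => ?_
      have := hm i
      rw [addRight_one_pow_apply, hi] at this
      rw [show i + 1 = Equiv.addRight (1 : ZMod p) i from rfl, this, Equiv.coe_addRight]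
      ring
    refine ⟨m, fun h0 => ?_, fun x => ?_⟩
    · have : h 1 = h 0 := by rw [haff 1, h0]; ring
      exact one_ne_zero (h.injective this)
    · have := hh 0 x
      simpa [haff x] using this
  -- A permutation commuting with x ↦ x + 1 is itself a translation, so the second alternative
  -- cannot occur.
  · refine absurd (pow_mem ((mem_powers_iff_mem_zpowers).1 ⟨(s 0).val, ?_⟩) 2) hs
    have haff : ∀ x, s x = s 0 + x := by
      refine ZMod.induction_add_of_ne_zero one_ne_zero (by simp) fun i hi => ?_
      have := DFunLike.congr_fun hc i
      simp only [Equiv.Perm.mul_apply, Equiv.coe_addRight] at this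
      rw [this, hi, add_assoc]
    ext x
    simp [haff x, add_comm]

/-! ### Isomorphisms of Cayley graphs on the dihedral group -/

/-- The relation `r` on the dihedral group is that of a Cayley graph whose connection set has
rotation part `S` and reflection part `B`. -/
structure IsDihedralRel {p : ℕ} (r : DihedralGroup p → DihedralGroup p → Prop)
    (S B : Set (ZMod p)) : Prop where
  rot_rot : ∀ i j, r (.r i) (.r j) ↔ j - i ∈ S
  refl_refl : ∀ i j, r (.sr i) (.sr j) ↔ j - i ∈ S
  rot_refl : ∀ i j, r (.r i) (.sr j) ↔ j - i ∈ B
  refl_rot : ∀ i j, r (.sr i) (.r j) ↔ i - j ∈ B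

/-- Right multiplication by the generating rotation. -/
def rotationPerm (p : ℕ) : Equiv.Perm (DihedralGroup p) := Equiv.mulRight (r 1)

@[simp] theorem rotationPerm_r {p : ℕ} (i : ZMod p) : rotationPerm p (r i) = r (i + 1) := rfl

@[simp] theorem rotationPerm_sr {p : ℕ} (i : ZMod p) : rotationPerm p (sr i) = sr (i + 1) := rfl

@[simp] theorem rotationPerm_pow_r {p : ℕ} (m : ℕ) (i : ZMod p) :
    (rotationPerm p ^ m) (r i) = r (i + (m : ZMod p)) := by
  induction m with
  | zero => simp
  | succ m ih => rw [pow_succ', Equiv.Perm.mul_apply, ih]; simp [add_assoc]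

@[simp] theorem rotationPerm_pow_sr {p : ℕ} (m : ℕ) (i : ZMod p) :
    (rotationPerm p ^ m) (sr i) = sr (i + (m : ZMod p)) := by
  induction m with
  | zero => simp
  | succ m ih => rw [pow_succ', Equiv.Perm.mul_apply, ih]; simp [add_assoc]

theorem orderOf_rotationPerm {p : ℕ} [hp : Fact p.Prime] : orderOf (rotationPerm p) = p := by
  refine orderOf_eq_prime ?_ ?_
  · ext (i | i) <;> simp
  · intro h
    simpa [-r_zero] using DFunLike.congr_fun h (r 0)

theorem IsDihedralRel.rotationPerm_mem {p : ℕ} {r : DihedralGroup p → DihedralGroup p → Prop}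
    {S B : Set (ZMod p)} (h : IsDihedralRel r S B) : rotationPerm p ∈ relAutSubgroup r := by
  rintro (i | i) (j | j) <;> simp [h.rot_rot, h.refl_refl, h.rot_refl, h.refl_rot]

/-- A permutation normalising the rotations acts affinely on each of their orbits. -/
theorem affine_of_apply_rotationPerm {p : ℕ} [hp : Fact p.Prime]
    {h : Equiv.Perm (DihedralGroup p)} {m : ℕ}
    (hm : ∀ x, h (rotationPerm p x) = (rotationPerm p ^ m) (h x)) :
    (m : ZMod p) ≠ 0 ∧ ∃ a b : ZMod p,
      ((∀ i, h (r i) = r (a + (m : ZMod p) * i)) ∧ ∀ i, h (sr i) = sr (b + (m : ZMod p) * i)) ∨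
      ((∀ i, h (r i) = sr (a + (m : ZMod p) * i)) ∧ ∀ i, h (sr i) = r (b + (m : ZMod p) * i)) := by
  have hr : ∀ i, h (r (i + 1)) = (rotationPerm p ^ m) (h (r i)) := fun i => hm (r i)
  have hs : ∀ i, h (sr (i + 1)) = (rotationPerm p ^ m) (h (sr i)) := fun i => hm (sr i)
  have hm0 : (m : ZMod p) ≠ 0 := by
    intro h0
    have h1 := hr 0
    have h2 : ∀ x, (rotationPerm p ^ m) x = x := by rintro (i | i) <;> simp [h0]
    rw [h2] at h1
    simpa [-r_zero] using h.injective h1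
  refine ⟨hm0, ?_⟩
  have rr : ∀ a, h (r 0) = r a → ∀ i, h (r i) = r (a + (m : ZMod p) * i) := fun a h0 =>
    ZMod.induction_add_of_ne_zero one_ne_zero (by simpa using h0) fun i hi => by
      rw [hr, hi, rotationPerm_pow_r]; congr 1; ring
  have rs : ∀ a, h (r 0) = sr a → ∀ i, h (r i) = sr (a + (m : ZMod p) * i) := fun a h0 =>
    ZMod.induction_add_of_ne_zero one_ne_zero (by simpa using h0) fun i hi => by
      rw [hr, hi, rotationPerm_pow_sr]; congr 1; ring
  have sr' : ∀ a, h (sr 0) = r a → ∀ i, h (sr i) = r (a + (m : ZMod p) * i) := fun a h0 =>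
    ZMod.induction_add_of_ne_zero one_ne_zero (by simpa using h0) fun i hi => by
      rw [hs, hi, rotationPerm_pow_r]; congr 1; ring
  have ss : ∀ a, h (sr 0) = sr a → ∀ i, h (sr i) = sr (a + (m : ZMod p) * i) := fun a h0 =>
    ZMod.induction_add_of_ne_zero one_ne_zero (by simpa using h0) fun i hi => by
      rw [hs, hi, rotationPerm_pow_sr]; congr 1; ring
  rcases ha : h (r 0) with a | a <;> rcases hb : h (sr 0) with b | b
  · exfalso
    -- The rotations already fill the coset containing `h (sr 0)`, against injectivity.
    have h1 := rr a ha ((b - a) / m)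
    rw [mul_div_cancel₀ _ hm0, add_sub_cancel, ← hb] at h1
    simpa using h.injective h1
  · exact ⟨a, b, .inl ⟨rr a ha, ss b hb⟩⟩
  · exact ⟨a, b, .inr ⟨rs a ha, sr' b hb⟩⟩
  · exfalso
    have h1 := rs a ha ((b - a) / m)
    rw [mul_div_cancel₀ _ hm0, add_sub_cancel, ← hb] at h1
    simpa using h.injective h1

/-- Isomorphic dihedral relations are related by an automorphism of the dihedral group, unless
the reflection part of the second one is trivial. -/
theorem IsDihedralRel.exists_affine_or_trivial {p : ℕ} [hp : Fact p.Prime] (hodd : Odd p)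
    {ρ ρ' : DihedralGroup p → DihedralGroup p → Prop} {S B S' B' : Set (ZMod p)}
    (hρ : IsDihedralRel ρ S B) (hρ' : IsDihedralRel ρ' S' B') (hneg : ∀ x, -x ∈ S' ↔ x ∈ S')
    {e : Equiv.Perm (DihedralGroup p)} (he : ∀ x y, ρ' (e x) (e y) ↔ ρ x y) :
    (∃ m c : ZMod p, m ≠ 0 ∧ (∀ x, m * x ∈ S' ↔ x ∈ S) ∧ ∀ x, m * x + c ∈ B' ↔ x ∈ B) ∨
      B' = ∅ ∨ B' = Set.univ := by
  have : Finite (DihedralGroup p) := inferInstance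
  rcases exists_iso_normalizing_or_exists_commute hodd he orderOf_rotationPerm
    hρ.rotationPerm_mem hρ'.rotationPerm_mem with ⟨h, m, hh, hm⟩ | ⟨s, hs, hc, hs2⟩
  · left
    obtain ⟨hm0, a, b, ⟨hr, hs⟩ | ⟨hr, hs⟩⟩ := affine_of_apply_rotationPerm hm
    · refine ⟨m, b - a, hm0, fun x => ?_, fun x => ?_⟩
      · have := hh (r 0) (r x)
        simpa [-r_zero, hr, hρ'.rot_rot, hρ.rot_rot] using this
      · have := hh (r 0) (sr x)
        rw [hr, hs, hρ'.rot_refl, hρ.rot_refl, sub_zero] at this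
        rw [← this]
        ring_nf
    -- Here `h` swaps the cosets, which reverses differences between them; the sign is harmless on
    -- `S'` by symmetry.
    · refine ⟨-m, a - b, neg_ne_zero.2 hm0, fun x => ?_, fun x => ?_⟩
      · have := hh (r 0) (r x)
        rw [neg_mul, hneg]
        simpa [-r_zero, hr, hρ'.refl_refl, hρ.rot_rot] using this
      · have := hh (r 0) (sr x)
        rw [hr, hs, hρ'.refl_rot, hρ.rot_refl, sub_zero] at this
        rw [← this]
        ring_nf
  · right
    obtain ⟨-, a, b, ⟨hr, hs'⟩ | ⟨hr, hs'⟩⟩ := affine_of_apply_rotationPerm (h := s) (m := 1)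
      fun x => by rw [pow_one]; exact DFunLike.congr_fun hc x
    · have hab : b - a ≠ 0 := fun h => by
        refine hs2 (pow_mem ((mem_powers_iff_mem_zpowers).1 ⟨a.val, ?_⟩) 2)
        ext (i | i)
        · simp [hr, add_comm]
        · simp [hs', sub_eq_zero.1 h, add_comm]
      -- The two cosets are shifted by different amounts, so `B'` is invariant under a nonzero
      -- translation.
      have hstep : ∀ x, x + (b - a) ∈ B' ↔ x ∈ B' := fun x => by
        have := hs (r 0) (sr x)
        rw [hr, hs', hρ'.rot_refl, hρ'.rot_refl, sub_zero] at this
        rw [← this]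
        simp only [Nat.cast_one]
        ring_nf
      by_cases h0 : (0 : ZMod p) ∈ B'
      · right
        exact Set.eq_univ_of_forall
          (ZMod.induction_add_of_ne_zero hab h0 fun i hi => (hstep i).2 hi)
      · left
        exact Set.eq_empty_of_forall_notMem
          (ZMod.induction_add_of_ne_zero hab h0 fun i hi => fun h => hi ((hstep i).1 h))
    · exfalso
      -- A swap of the cosets commuting with the rotation squares to a shift by `a + b`, a power of
      -- the rotation. Excluding such swaps is why the condition concerns `s ^ 2` and not `s`.
      refine hs2 ((mem_powers_iff_mem_zpowers).1 ⟨(a + b).val, ?_⟩)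
      ext (i | i)
      · simp [hr, hs', pow_two]; ring
      · simp [hr, hs', pow_two]; ring

/-- Two disjoint copies of a circulant determine it up to a multiplier. -/
theorem IsDihedralRel.exists_multiplier_of_empty {p : ℕ} [hp : Fact p.Prime] (hodd : Odd p)
    {ρ ρ' : DihedralGroup p → DihedralGroup p → Prop} {S S' : Set (ZMod p)}
    (hρ : IsDihedralRel ρ S ∅) (hρ' : IsDihedralRel ρ' S' ∅) (hS : (0 : ZMod p) ∉ S)
    {e : Equiv.Perm (DihedralGroup p)} (he : ∀ x y, ρ' (e x) (e y) ↔ ρ x y) :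
    ∃ m : ZMod p, m ≠ 0 ∧ ∀ x, m * x ∈ S' ↔ x ∈ S := by
  rcases S.eq_empty_or_nonempty with rfl | ⟨s, hs⟩
  · refine ⟨1, one_ne_zero, fun x => ?_⟩
    have := he (e.symm (r 0)) (e.symm (r x))
    rw [e.apply_symm_apply, e.apply_symm_apply, hρ'.rot_rot, sub_zero] at this
    rw [one_mul, this]
    rcases e.symm (r 0) with i | i <;> rcases e.symm (r x) with j | j <;>
      simp [hρ.rot_rot, hρ.refl_refl, hρ.rot_refl, hρ.refl_rot]
  have hs0 : s ≠ 0 := fun h => hS (h ▸ hs)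
  -- Since `ρ'` has no edges between the cosets, following steps of `s` keeps the image of the
  -- rotations inside one coset; `e` thus restricts to an isomorphism of circulants.
  have hadj : ∀ i, ρ' (e (r i)) (e (r (i + s))) := fun i => by
    rw [he, hρ.rot_rot]; simpa using hs
  have finish : ∀ g : ZMod p → ZMod p, Function.Injective g →
      (∀ i j, g j - g i ∈ S' ↔ j - i ∈ S) →
      ∃ m : ZMod p, m ≠ 0 ∧ ∀ x, m * x ∈ S' ↔ x ∈ S := fun g hg h =>
    exists_multiplier_of_circulant_iso hodd
      (e := Equiv.ofBijective g (Finite.injective_iff_bijective.1 hg)) h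
  rcases h0 : e (r 0) with a | a
  · have : ∀ i, ∃ b, e (r i) = r b := by
      refine ZMod.induction_add_of_ne_zero hs0 ⟨a, h0⟩ ?_
      rintro i ⟨b, hb⟩
      have := hadj i
      rcases h1 : e (r (i + s)) with c | c
      · exact ⟨c, rfl⟩
      · simp [hb, h1, hρ'.rot_refl] at this
    choose g hg using this
    refine finish g (fun i j hij => ?_) fun i j => ?_
    · simpa using e.injective ((hg i).trans ((congrArg r hij).trans (hg j).symm))
    · have := he (r i) (r j)
      rwa [hg, hg, hρ'.rot_rot, hρ.rot_rot] at this
  · have : ∀ i, ∃ b, e (r i) = sr b := by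
      refine ZMod.induction_add_of_ne_zero hs0 ⟨a, h0⟩ ?_
      rintro i ⟨b, hb⟩
      have := hadj i
      rcases h1 : e (r (i + s)) with c | c
      · simp [hb, h1, hρ'.refl_rot] at this
      · exact ⟨c, rfl⟩
    choose g hg using this
    refine finish g (fun i j hij => ?_) fun i j => ?_
    · simpa using e.injective ((hg i).trans ((congrArg sr hij).trans (hg j).symm))
    · have := he (r i) (r j)
      rwa [hg, hg, hρ'.refl_refl, hρ.rot_rot] at this

/-- The complement of a dihedral relation. -/
theorem IsDihedralRel.compl {p : ℕ} {ρ : DihedralGroup p → DihedralGroup p → Prop}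
    {S B : Set (ZMod p)} (h : IsDihedralRel ρ S B) :
    IsDihedralRel (fun x y => x ≠ y ∧ ¬ ρ x y) (Sᶜ \ {0}) Bᶜ where
  rot_rot i j := by simp [h.rot_rot, sub_eq_zero, and_comm, eq_comm]
  refl_refl i j := by simp [h.refl_refl, sub_eq_zero, and_comm, eq_comm]
  rot_refl i j := by simp [h.rot_refl]
  refl_rot i j := by simp [h.refl_rot]

/-- No isomorphism leads from two disjoint circulants to the join of two circulants. -/
theorem IsDihedralRel.not_iso_empty_univ {p : ℕ}
    {ρ ρ' : DihedralGroup p → DihedralGroup p → Prop} {S S' : Set (ZMod p)}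
    (hρ : IsDihedralRel ρ S ∅) (hρ' : IsDihedralRel ρ' S' Set.univ)
    {e : Equiv.Perm (DihedralGroup p)} (he : ∀ x y, ρ' (e x) (e y) ↔ ρ x y) : False := by
  have h1 : ¬ ρ' (e (r 0)) (e (sr 0)) := by rw [he, hρ.rot_refl]; simp
  -- In a join, vertices on opposite sides are adjacent and vertices on the same side have a common
  -- neighbour; `r 0` and `sr 0` have neither property in the disjoint union.
  have h2 : ∀ y, ¬ (ρ' (e (r 0)) y ∧ ρ' y (e (sr 0))) := by
    intro y
    rw [← e.apply_symm_apply y, he, he]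
    rcases e.symm y with i | i <;> simp [-r_zero, hρ.rot_refl]
  rcases ha : e (r 0) with a | a <;> rcases hb : e (sr 0) with b | b <;> rw [ha, hb] at h1 h2
  · exact h2 (sr 0) (by simp [hρ'.rot_refl, hρ'.refl_rot])
  · exact h1 (by simp [hρ'.rot_refl])
  · exact h1 (by simp [hρ'.refl_rot])
  · exact h2 (r 0) (by simp [-r_zero, hρ'.rot_refl, hρ'.refl_rot])

/-- **Babai's theorem** for graphs: isomorphic Cayley graphs on the dihedral group of order `2p`
are related by an automorphism of the group. -/
theorem IsDihedralRel.exists_affine_of_iso {p : ℕ} [hp : Fact p.Prime] (hodd : Odd p)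
    {ρ ρ' : DihedralGroup p → DihedralGroup p → Prop} {S B S' B' : Set (ZMod p)}
    (hρ : IsDihedralRel ρ S B) (hρ' : IsDihedralRel ρ' S' B')
    (hneg : ∀ x, -x ∈ S ↔ x ∈ S) (hneg' : ∀ x, -x ∈ S' ↔ x ∈ S')
    (h0 : (0 : ZMod p) ∉ S) (h0' : (0 : ZMod p) ∉ S')
    {e : Equiv.Perm (DihedralGroup p)} (he : ∀ x y, ρ' (e x) (e y) ↔ ρ x y) :
    ∃ m c : ZMod p, m ≠ 0 ∧ (∀ x, m * x ∈ S' ↔ x ∈ S) ∧ ∀ x, m * x + c ∈ B' ↔ x ∈ B := by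
  have he' : ∀ x y, ρ (e.symm x) (e.symm y) ↔ ρ' x y := fun x y => by
    rw [← he, e.apply_symm_apply, e.apply_symm_apply]
  rcases hρ.exists_affine_or_trivial hodd hρ' hneg' he with h | hB'
  · exact h
  -- Applying the dichotomy to the inverse isomorphism makes `B` trivial too, or gives an affine map
  -- to invert.
  rcases hρ'.exists_affine_or_trivial hodd hρ hneg he' with ⟨m, c, hm, hS, hB⟩ | hB
  · refine ⟨m⁻¹, -(m⁻¹ * c), inv_ne_zero hm, fun x => ?_, fun x => ?_⟩
    · rw [← hS, mul_inv_cancel_left₀ hm]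
    · rw [← hB, mul_add, mul_inv_cancel_left₀ hm, mul_neg, mul_inv_cancel_left₀ hm,
        neg_add_cancel_right]
  rcases hB with rfl | rfl <;> rcases hB' with rfl | rfl
  · obtain ⟨m, hm, h⟩ := hρ.exists_multiplier_of_empty hodd hρ' h0 he
    exact ⟨m, 0, hm, h, by simp⟩
  · exact (hρ.not_iso_empty_univ hρ' he).elim
  · exact (hρ'.not_iso_empty_univ hρ he').elim
  · have hc := hρ.compl
    have hc' := hρ'.compl
    rw [Set.compl_univ] at hc hc'
    obtain ⟨m, hm, h⟩ := hc.exists_multiplier_of_empty hodd hc' (e := e) (by simp)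
      fun x y => by rw [he, e.injective.ne_iff]
    refine ⟨m, 0, hm, fun x => ?_, by simp⟩
    by_cases hx : x = 0
    · simp [hx, h0, h0']
    · have := h x
      simpa [hx, hm, not_iff_not] using this

/-! ### Burnside's lemma and invariant subsets of abelian groups -/

theorem smul_set_eq_iff_forall_smul_mem_iff {G X : Type*} [Group G] [MulAction G X] {g : G}
    {A B : Set X} : g • A = B ↔ ∀ x, g • x ∈ B ↔ x ∈ A := by
  constructor
  · rintro rfl x
    exact Set.smul_mem_smul_set_iff
  · intro h
    ext x
    rw [Set.mem_smul_set_iff_inv_smul_mem, ← h, smul_inv_smul]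

/-- **Burnside's lemma**, for `Nat.card`. -/
theorem sum_natCard_fixedBy (G X : Type*) [Group G] [Fintype G] [MulAction G X] [Finite X] :
    ∑ g : G, Nat.card (MulAction.fixedBy X g) =
      Nat.card (MulAction.orbitRel.Quotient G X) * Nat.card G := by
  classical
  have := Fintype.ofFinite X
  have := Fintype.ofFinite (MulAction.orbitRel.Quotient G X)
  simp only [Nat.card_eq_fintype_card]
  exact MulAction.sum_card_fixedBy_eq_card_orbits_mul_card_group G X

theorem natCard_fixedBy_prod {G X Y : Type*} [Group G] [MulAction G X] [MulAction G Y] (g : G) :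
    Nat.card (MulAction.fixedBy (X × Y) g) =
      Nat.card (MulAction.fixedBy X g) * Nat.card (MulAction.fixedBy Y g) := by
  rw [← Nat.card_prod]
  refine Nat.card_congr ((Equiv.setCongr ?_).trans (Equiv.Set.prod _ _))
  ext ⟨x, y⟩
  simp [MulAction.mem_fixedBy]

/-- The number of subsets of a finite abelian group that are stable under multiplication by `c`. -/
theorem natCard_fixedBy_set_eq_two_pow_index {C : Type*} [CommGroup C] [Finite C] (c : C) :
    Nat.card (MulAction.fixedBy (Set C) c) = 2 ^ (Subgroup.zpowers c).index := by
  have e : Set (C ⧸ Subgroup.zpowers c) ≃ MulAction.fixedBy (Set C) c := by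
    refine Equiv.ofBijective (fun U => ⟨((↑) : C → C ⧸ Subgroup.zpowers c) ⁻¹' U, ?_⟩) ⟨?_, ?_⟩
    · rw [MulAction.mem_fixedBy, smul_set_eq_iff_forall_smul_mem_iff]
      intro x
      have : ((c • x : C) : C ⧸ Subgroup.zpowers c) = x := by
        rw [eq_comm, QuotientGroup.eq, smul_eq_mul, mul_comm c x, inv_mul_cancel_left]
        exact Subgroup.mem_zpowers c
      rw [Set.mem_preimage, this, Set.mem_preimage]
    · intro U U' h
      exact Set.preimage_injective.2 QuotientGroup.mk_surjective (congrArg Subtype.val h)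
    · rintro ⟨T, hT⟩
      refine ⟨((↑) : C → C ⧸ Subgroup.zpowers c) '' T, Subtype.ext ?_⟩
      refine Set.Subset.antisymm ?_ (Set.subset_preimage_image _ _)
      rintro x ⟨t, ht, htx⟩
      -- A set fixed by `c` is stabilised by all of ⟨c⟩, hence is a union of cosets.
      have hz : t⁻¹ * x ∈ MulAction.stabilizer C T :=
        (Subgroup.zpowers_le (H := MulAction.stabilizer C T)).2 hT (QuotientGroup.eq.1 htx)
      have := Set.smul_mem_smul_set (a := t⁻¹ * x) ht
      rwa [MulAction.mem_stabilizer_iff.1 hz, smul_eq_mul, mul_comm, mul_inv_cancel_left] at this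
  rw [← Nat.card_congr e, Subgroup.index]
  have := Fintype.ofFinite (C ⧸ Subgroup.zpowers c)
  rw [Nat.card_eq_fintype_card, Nat.card_eq_fintype_card, Fintype.card_set]

theorem index_zpowers_eq_card_div_orderOf {C : Type*} [Group C] [Finite C] (c : C) :
    (Subgroup.zpowers c).index = Nat.card C / orderOf c := by
  rw [← Nat.card_zpowers, ← (Subgroup.zpowers c).index_mul_card,
    Nat.mul_div_cancel _ Nat.card_pos]

theorem index_zpowers_pow_of_generator {C : Type*} [Group C] [Finite C] {g : C}
    (hg : orderOf g = Nat.card C) (i : ℕ) :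
    (Subgroup.zpowers (g ^ i)).index = Nat.gcd i (Nat.card C) := by
  rw [index_zpowers_eq_card_div_orderOf, orderOf_pow, hg, Nat.gcd_comm,
    Nat.div_div_self (Nat.gcd_dvd_right _ _) Nat.card_pos.ne']

/-- The number of subsets of a finite cyclic group up to multiplication by group elements. -/
theorem natCard_orbits_set_of_isCyclic {C : Type*} [CommGroup C] [Finite C] [IsCyclic C] :
    Nat.card (MulAction.orbitRel.Quotient C (Set C)) * Nat.card C =
      ∑ d ∈ (Nat.card C).divisors, d.totient * 2 ^ (Nat.card C / d) := by
  classical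
  have := Fintype.ofFinite C
  rw [← sum_natCard_fixedBy, ← Finset.sum_fiberwise_of_maps_to (g := orderOf)
    (t := (Nat.card C).divisors) fun c _ => Nat.mem_divisors.2 ⟨orderOf_dvd_natCard c,
      Nat.card_pos.ne'⟩]
  refine Finset.sum_congr rfl fun d hd => ?_
  rw [Finset.sum_congr rfl (g := fun _ => 2 ^ (Nat.card C / d)), Finset.sum_const, smul_eq_mul]
  · congr 1
    rw [IsCyclic.card_orderOf_eq_totient]
    rw [← Nat.card_eq_fintype_card]
    exact Nat.dvd_of_mem_divisors hd
  · intro c hc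
    rw [natCard_fixedBy_set_eq_two_pow_index, index_zpowers_eq_card_div_orderOf,
      (Finset.mem_filter.1 hc).2]

theorem sum_eq_sum_range_pow_of_generator {C M : Type*} [Group C] [Fintype C] [AddCommMonoid M]
    {g : C} (hg : ∀ x, x ∈ Subgroup.zpowers g) (f : C → M) :
    ∑ x, f x = ∑ i ∈ Finset.range (orderOf g), f (g ^ i) := by
  classical
  rw [← IsCyclic.image_range_orderOf hg, Finset.sum_image]
  intro i hi j hj h
  exact pow_injOn_Iio_orderOf (by simpa using hi) (by simpa using hj) h

/-! ### Units up to sign, the affine group and its orbit count -/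

/-- The units modulo `p` up to sign. -/
abbrev UnitsModNeg (p : ℕ) : Type := (ZMod p)ˣ ⧸ Subgroup.zpowers (-1 : (ZMod p)ˣ)

theorem UnitsModNeg.mk_eq_mk {p : ℕ} {u v : (ZMod p)ˣ} :
    (u : UnitsModNeg p) = v ↔ v = u ∨ v = -u := by
  rw [QuotientGroup.eq, Subgroup.mem_zpowers_iff]
  constructor
  · rintro ⟨k, hk⟩
    rw [eq_inv_mul_iff_mul_eq] at hk
    rcases Int.even_or_odd k with h | h
    · left; rw [← hk, h.neg_one_zpow, mul_one]
    · right; rw [← hk, h.neg_one_zpow, mul_neg_one]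
  · rintro (rfl | rfl)
    · exact ⟨0, by simp⟩
    · exact ⟨1, by simp⟩

theorem UnitsModNeg.natCard {p : ℕ} [hp : Fact p.Prime] (hodd : Odd p) :
    Nat.card (UnitsModNeg p) = (p - 1) / 2 := by
  have h1 : orderOf (-1 : (ZMod p)ˣ) = 2 := by
    refine orderOf_eq_prime (by simp) fun h => ?_
    have := Fact.mk (lt_of_le_of_ne hp.out.two_le fun h => by rw [← h] at hodd; revert hodd; decide)
    exact ZMod.neg_one_ne_one (n := p) (by simpa using congrArg Units.val h)
  change (Subgroup.zpowers (-1 : (ZMod p)ˣ)).index = _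
  rw [index_zpowers_eq_card_div_orderOf, h1, Nat.card_eq_fintype_card, ZMod.card_units]

/-- Affine bijections of `ZMod p`. -/
@[ext] structure AffineGroup (p : ℕ) where
  lin : (ZMod p)ˣ
  trans : ZMod p

namespace AffineGroup

variable {p : ℕ}

instance : Mul (AffineGroup p) := ⟨fun g h => ⟨g.lin * h.lin, g.lin * h.trans + g.trans⟩⟩

instance : One (AffineGroup p) := ⟨⟨1, 0⟩⟩

instance : Inv (AffineGroup p) := ⟨fun g => ⟨g.lin⁻¹, -(↑g.lin⁻¹ * g.trans)⟩⟩

@[simp] theorem lin_mul (g h : AffineGroup p) : (g * h).lin = g.lin * h.lin := rfl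

@[simp] theorem trans_mul (g h : AffineGroup p) :
    (g * h).trans = g.lin * h.trans + g.trans := rfl

@[simp] theorem lin_one : (1 : AffineGroup p).lin = 1 := rfl

@[simp] theorem trans_one : (1 : AffineGroup p).trans = 0 := rfl

@[simp] theorem lin_inv (g : AffineGroup p) : g⁻¹.lin = g.lin⁻¹ := rfl

@[simp] theorem trans_inv (g : AffineGroup p) : g⁻¹.trans = -(↑g.lin⁻¹ * g.trans) := rfl

instance : Group (AffineGroup p) :=
  Group.ofLeftAxioms (fun a b c => by ext <;> simp [mul_assoc]; ring) (fun a => by ext <;> simp)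
    (fun a => by ext <;> simp)

/-- The affine group as a set of pairs. -/
def equivProd : AffineGroup p ≃ (ZMod p)ˣ × ZMod p where
  toFun g := (g.lin, g.trans)
  invFun x := ⟨x.1, x.2⟩
  left_inv _ := rfl
  right_inv _ := rfl

instance [NeZero p] : Fintype (AffineGroup p) := Fintype.ofEquiv _ equivProd.symm

instance : MulAction (AffineGroup p) (ZMod p) where
  smul g x := g.lin * x + g.trans
  one_smul x := by change ((1 : AffineGroup p).lin : ZMod p) * x + (1 : AffineGroup p).trans = x; simp
  mul_smul g h x := by
    change ((g * h).lin : ZMod p) * x + (g * h).trans = g.lin * (h.lin * x + h.trans) + g.trans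
    simp; ring

theorem smul_def (g : AffineGroup p) (x : ZMod p) : g • x = g.lin * x + g.trans := rfl

instance : MulAction (AffineGroup p) (UnitsModNeg p) where
  smul g x := (g.lin : UnitsModNeg p) * x
  one_smul x := one_mul x
  mul_smul g h x := mul_assoc (g.lin : UnitsModNeg p) (h.lin : UnitsModNeg p) x

theorem smul_set_units (g : AffineGroup p) (S : Set (UnitsModNeg p)) :
    g • S = (g.lin : UnitsModNeg p) • S := rfl

theorem natCard_fixedBy_set_units [NeZero p] (g : AffineGroup p) :
    Nat.card (MulAction.fixedBy (Set (UnitsModNeg p)) g) =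
      2 ^ (Subgroup.zpowers (g.lin : UnitsModNeg p)).index := by
  refine Eq.trans ?_ (natCard_fixedBy_set_eq_two_pow_index (g.lin : UnitsModNeg p))
  refine Nat.card_congr (Equiv.setCongr ?_)
  ext S
  rw [MulAction.mem_fixedBy, MulAction.mem_fixedBy, smul_set_units]

variable [hp : Fact p.Prime]

/-- For m ≠ 1 the map x ↦ mx + c has a fixed point. Centred there it is multiplication by m, so an
invariant set is a free choice at that point together with an m-invariant set of units. -/
theorem natCard_fixedBy_set_of_ne_one {m : (ZMod p)ˣ} (hm : m ≠ 1) (c : ZMod p) :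
    Nat.card (MulAction.fixedBy (Set (ZMod p)) (⟨m, c⟩ : AffineGroup p)) =
      2 * 2 ^ (Subgroup.zpowers m).index := by
  have hm' : (1 : ZMod p) - m ≠ 0 := fun h => hm (Units.ext (sub_eq_zero.1 h).symm)
  obtain ⟨x₀, hx₀⟩ : ∃ x₀ : ZMod p, m * x₀ + c = x₀ := ⟨c / (1 - m), by field_simp; ring⟩
  have hact : ∀ x, (⟨m, c⟩ : AffineGroup p) • (x + x₀) = m * x + x₀ := fun x => by
    rw [smul_def]
    linear_combination hx₀
  rw [← natCard_fixedBy_set_eq_two_pow_index, show 2 = Nat.card Prop by simp, ← Nat.card_prod]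
  refine Nat.card_congr (Equiv.ofBijective
    (fun B => (x₀ ∈ B.1, ⟨{u | (u : ZMod p) + x₀ ∈ B.1}, ?_⟩)) ⟨?_, ?_⟩)
  · rw [MulAction.mem_fixedBy, smul_set_eq_iff_forall_smul_mem_iff]
    intro u
    have := smul_set_eq_iff_forall_smul_mem_iff.1 (MulAction.mem_fixedBy.1 B.2) (u + x₀)
    rw [hact] at this
    simpa using this
  · rintro ⟨B, hB⟩ ⟨B', hB'⟩ h
    obtain ⟨h1, h2⟩ := Prod.ext_iff.1 h
    have h2 := congrArg Subtype.val h2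
    refine Subtype.ext (Set.ext fun x => ?_)
    by_cases hx : x = x₀
    · rw [hx]; exact iff_of_eq h1
    · have := Set.ext_iff.1 h2 (Units.mk0 (x - x₀) (sub_ne_zero.2 hx))
      simpa using this
  · rintro ⟨P, U, hU⟩
    have key : ∀ x : ZMod p, x + x₀ ∈ {y : ZMod p | (y = x₀ ∧ P) ∨ ∃ u ∈ U, (u : ZMod p) + x₀ = y} ↔
        (x = 0 ∧ P) ∨ ∃ u ∈ U, (u : ZMod p) = x := fun x => by simp
    refine ⟨⟨{y | (y = x₀ ∧ P) ∨ ∃ u ∈ U, (u : ZMod p) + x₀ = y}, ?_⟩, ?_⟩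
    · rw [MulAction.mem_fixedBy, smul_set_eq_iff_forall_smul_mem_iff]
      intro x
      obtain ⟨y, rfl⟩ : ∃ y, y + x₀ = x := ⟨x - x₀, sub_add_cancel _ _⟩
      rw [hact, key, key]
      refine or_congr (by simp) ?_
      have hU' := smul_set_eq_iff_forall_smul_mem_iff.1 (MulAction.mem_fixedBy.1 hU)
      constructor
      · rintro ⟨u, hu, h⟩
        refine ⟨m⁻¹ * u, (hU' _).1 (by simpa using hu), ?_⟩
        rw [Units.val_mul, h, Units.inv_mul_cancel_left]
      · rintro ⟨u, hu, rfl⟩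
        exact ⟨m * u, (hU' u).2 hu, by simp⟩
    · refine Prod.ext ?_ (Subtype.ext (Set.ext fun u => ?_))
      · simp
      · simp only [Set.mem_ofPred_eq]
        have := key u
        simp only [Set.mem_ofPred_eq] at this
        rw [this]
        simp [Units.val_inj]

theorem natCard_fixedBy_set_one : Nat.card (MulAction.fixedBy (Set (ZMod p)) (1 : AffineGroup p)) =
    2 ^ p := by
  rw [MulAction.fixedBy_one_eq_univ, Nat.card_congr (Equiv.Set.univ _), Nat.card_eq_fintype_card,
    Fintype.card_set, ZMod.card]

theorem natCard_fixedBy_set_translation {c : ZMod p} (hc : c ≠ 0) :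
    Nat.card (MulAction.fixedBy (Set (ZMod p)) (⟨1, c⟩ : AffineGroup p)) = 2 := by
  have : MulAction.fixedBy (Set (ZMod p)) (⟨1, c⟩ : AffineGroup p) = {∅, Set.univ} := by
    ext B
    rw [MulAction.mem_fixedBy, smul_set_eq_iff_forall_smul_mem_iff]
    constructor
    · intro h
      have h : ∀ x, x + c ∈ B ↔ x ∈ B := fun x => by simpa [smul_def] using h x
      by_cases h0 : (0 : ZMod p) ∈ B
      · right
        exact Set.eq_univ_of_forall
          (ZMod.induction_add_of_ne_zero hc h0 fun i hi => (h i).2 hi)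
      · left
        exact Set.eq_empty_of_forall_notMem
          (ZMod.induction_add_of_ne_zero hc h0 fun i hi => fun h' => hi ((h i).1 h'))
    · rintro (rfl | rfl) <;> simp
  rw [this, Nat.card_coe_set_eq, Set.ncard_pair Set.empty_ne_univ]

/-- The uniform term needs correcting only at m = 1, where the identity fixes all `2 ^ p` sets and
each other translation just two. The correction becomes the first summand of `dihedralCount`. -/
theorem sum_natCard_fixedBy_set (m : (ZMod p)ˣ) :
    (∑ c : ZMod p, Nat.card (MulAction.fixedBy (Set (ZMod p)) (⟨m, c⟩ : AffineGroup p)) : ℚ) =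
      2 * p * 2 ^ (Subgroup.zpowers m).index +
        if m = 1 then 2 ^ p + 2 * ((p : ℚ) - 1) - p * 2 ^ p else 0 := by
  split_ifs with h
  · subst h
    rw [← Finset.add_sum_erase _ _ (Finset.mem_univ (0 : ZMod p)),
      Finset.sum_congr rfl (g := fun _ => (2 : ℚ))]
    · rw [show (⟨1, 0⟩ : AffineGroup p) = 1 from rfl, natCard_fixedBy_set_one, Finset.sum_const,
        Finset.card_erase_of_mem (Finset.mem_univ _), Finset.card_univ, ZMod.card, nsmul_eq_mul,
        Nat.cast_pred hp.out.pos, Subgroup.zpowers_one_eq_bot, Subgroup.index_bot,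
        Nat.card_eq_fintype_card, ZMod.card_units]
      have : (2 : ℚ) ^ p = 2 * 2 ^ (p - 1) := by
        rw [← pow_succ', Nat.sub_add_cancel hp.out.one_le]
      push_cast
      linear_combination (p : ℚ) * this
    · intro c hc
      exact_mod_cast natCard_fixedBy_set_translation (Finset.ne_of_mem_erase hc)
  · simp only [natCard_fixedBy_set_of_ne_one h, Finset.sum_const, Finset.card_univ, ZMod.card,
      nsmul_eq_mul]
    push_cast
    ring

end AffineGroup

open AffineGroup in
/-- The number of pairs of a subset of `UnitsModNeg p` and a subset of `ZMod p` up to affine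
bijections. -/
theorem natCard_orbits_affineGroup {p : ℕ} [hp : Fact p.Prime] (hodd : Odd p) :
    (Nat.card (MulAction.orbitRel.Quotient (AffineGroup p) (Set (UnitsModNeg p) × Set (ZMod p))) :
      ℚ) = dihedralCount p := by
  have hcard : Nat.card (AffineGroup p) = (p - 1) * p := by
    rw [Nat.card_congr equivProd, Nat.card_prod, Nat.card_eq_fintype_card, ZMod.card_units,
      Nat.card_zmod]
  have hp0 : (p : ℚ) ≠ 0 := by exact_mod_cast hp.out.ne_zero
  have hp1 : (p : ℚ) - 1 ≠ 0 := sub_ne_zero.2 (by exact_mod_cast hp.out.one_lt.ne')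
  obtain ⟨n, hn⟩ := hodd
  have hU : Nat.card (UnitsModNeg p) = n := by
    rw [UnitsModNeg.natCard ⟨n, hn⟩]; omega
  have hK : Nat.card (ZMod p)ˣ = p - 1 := by rw [Nat.card_eq_fintype_card, ZMod.card_units]
  obtain ⟨g, hg⟩ := IsCyclic.exists_generator (α := (ZMod p)ˣ)
  have hgo : orderOf g = Nat.card (ZMod p)ˣ := orderOf_eq_card_of_forall_mem_zpowers hg
  have hgo' : orderOf (g : UnitsModNeg p) = Nat.card (UnitsModNeg p) := by
    refine orderOf_eq_card_of_forall_mem_zpowers fun x => ?_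
    obtain ⟨u, rfl⟩ := QuotientGroup.mk_surjective x
    obtain ⟨k, rfl⟩ := hg u
    exact ⟨k, rfl⟩
  have hW : ∑ m : (ZMod p)ˣ, (2 : ℚ) ^ (Subgroup.zpowers (m : UnitsModNeg p)).index *
      2 ^ (Subgroup.zpowers m).index =
      ∑ i ∈ Finset.range (p - 1), 2 ^ (Nat.gcd (2 * i) (p - 1) / 2 + Nat.gcd i (p - 1)) := by
    rw [sum_eq_sum_range_pow_of_generator hg, hgo, hK]
    refine Finset.sum_congr rfl fun i _ => ?_
    -- With `p - 1 = 2 * n`, half of gcd(2i, p - 1) is gcd(i, n), the index of the i-th power of the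
    -- generator in the quotient of order `n`.
    rw [pow_add, index_zpowers_pow_of_generator hgo, hK, QuotientGroup.mk_pow,
      index_zpowers_pow_of_generator hgo', hU, show p - 1 = 2 * n by omega, Nat.gcd_mul_left,
      Nat.mul_div_cancel_left _ two_pos]
  have key := congrArg (Nat.cast : ℕ → ℚ)
    (sum_natCard_fixedBy (AffineGroup p) (Set (UnitsModNeg p) × Set (ZMod p)))
  rw [Nat.cast_mul, hcard, Nat.cast_mul, Nat.cast_pred hp.out.pos, Nat.cast_sum,
    ← equivProd.symm.sum_comp, Fintype.sum_prod_type] at key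
  simp only [natCard_fixedBy_prod, natCard_fixedBy_set_units, Nat.cast_mul] at key
  change ∑ m : (ZMod p)ˣ, ∑ c : ZMod p,
    (((2 ^ (Subgroup.zpowers (m : UnitsModNeg p)).index : ℕ) : ℚ) *
      (Nat.card (MulAction.fixedBy (Set (ZMod p)) (⟨m, c⟩ : AffineGroup p)) : ℚ)) = _ at key
  simp only [← Finset.mul_sum, sum_natCard_fixedBy_set, mul_add, mul_ite, mul_zero,
    Finset.sum_add_distrib, Finset.sum_ite_eq', Finset.mem_univ, if_true] at key
  have h1 : (Subgroup.zpowers ((1 : (ZMod p)ˣ) : UnitsModNeg p)).index = n := by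
    rw [QuotientGroup.mk_one, Subgroup.zpowers_one_eq_bot, Subgroup.index_bot, hU]
  have h2 : ∑ m : (ZMod p)ˣ, ((2 ^ (Subgroup.zpowers (m : UnitsModNeg p)).index : ℕ) : ℚ) *
      (2 * p * 2 ^ (Subgroup.zpowers m).index) = 2 * p * ∑ i ∈ Finset.range (p - 1),
        2 ^ (Nat.gcd (2 * i) (p - 1) / 2 + Nat.gcd i (p - 1)) := by
    rw [← hW, Finset.mul_sum]
    refine Finset.sum_congr rfl fun m _ => ?_
    push_cast
    ring
  rw [h2, h1] at key
  have h3 : (2 : ℚ) ^ ((p + 1) / 2) = 2 * 2 ^ n := by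
    rw [← pow_succ']; congr 1; omega
  have h4 : (2 : ℚ) ^ ((3 * p - 1) / 2) = 2 ^ n * 2 ^ p := by
    rw [← pow_add]; congr 1; omega
  rw [dihedralCount, h3, h4]
  push_cast at key
  field_simp
  linear_combination -key

/-! ### Counting isomorphism classes -/

/-- The classes of a setoid are counted by the values of a function that separates them. -/
theorem ncard_range_eq_natCard_quotient {X Y : Type*} (s : Setoid X) (φ : X → Y)
    (h : ∀ x y, φ x = φ y ↔ s x y) : (Set.range φ).ncard = Nat.card (Quotient s) := by
  obtain rfl : Setoid.ker φ = s := Setoid.ext h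
  exact (Nat.card_congr (Setoid.quotientKerEquivRange φ)).symm

/-- The isomorphism class of a graph. -/
def isoClass {V : Type*} (Γ : SimpleGraph V) : Quotient (graphIsoSetoid V) :=
  Quotient.mk _ Γ

theorem isoClass_eq {V : Type*} {Γ Δ : SimpleGraph V} :
    isoClass Γ = isoClass Δ ↔ Nonempty (Γ ≃g Δ) :=
  Quotient.eq

theorem numUpToIso_eq_ncard {V : Type*} (P : SimpleGraph V → Prop) :
    numUpToIso P = (isoClass '' {Γ | P Γ}).ncard := by
  have : isoClass '' {Γ | P Γ} = Set.range fun Γ : {Γ // P Γ} => isoClass Γ.1 := by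
    ext c; simp
  rw [this, ncard_range_eq_natCard_quotient
    ((graphIsoSetoid V).comap (Subtype.val : {Γ : SimpleGraph V // P Γ} → _))]
  · rfl
  · intro Γ Δ
    rw [isoClass_eq]
    rfl

/-- Invariance of `Q` under isomorphism prevents a class from being counted on both sides. -/
theorem numUpToIso_and_add_numUpToIso_and_not {V : Type*} [Finite V]
    {P Q : SimpleGraph V → Prop} (hQ : ∀ Γ Δ, Nonempty (Γ ≃g Δ) → Q Γ → Q Δ) :
    numUpToIso (fun Γ => P Γ ∧ Q Γ) + numUpToIso (fun Γ => P Γ ∧ ¬ Q Γ) = numUpToIso P := by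
  have : Finite (SimpleGraph V) := Finite.of_injective _ SimpleGraph.adj_injective
  simp only [numUpToIso_eq_ncard]
  rw [← Set.ncard_union_eq ?_ (Set.toFinite _) (Set.toFinite _), ← Set.image_union]
  · congr 2
    ext Γ
    simp only [Set.mem_union, Set.mem_ofPred_eq]
    tauto
  · rw [Set.disjoint_left]
    rintro _ ⟨Γ, ⟨-, hΓ⟩, rfl⟩ ⟨Δ, ⟨-, hΔ⟩, h⟩
    exact hΔ (hQ _ _ (isoClass_eq.1 h.symm) hΓ)

/-! ### Circulant graphs as orbits of connection sets -/

section

variable {p : ℕ}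

/-- The nonzero residues whose class up to sign is in `S`. -/
def liftSet (S : Set (UnitsModNeg p)) : Set (ZMod p) :=
  {x | ∃ u : (ZMod p)ˣ, (u : UnitsModNeg p) ∈ S ∧ ↑u = x}

theorem coe_mem_liftSet {S : Set (UnitsModNeg p)} {u : (ZMod p)ˣ} :
    (u : ZMod p) ∈ liftSet S ↔ (u : UnitsModNeg p) ∈ S := by
  constructor
  · rintro ⟨v, hv, h⟩
    rwa [← Units.ext h]
  · exact fun h => ⟨u, h, rfl⟩

theorem neg_mem_liftSet {S : Set (UnitsModNeg p)} {x : ZMod p} :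
    -x ∈ liftSet S ↔ x ∈ liftSet S := by
  have key : ∀ y, y ∈ liftSet S → -y ∈ liftSet S := by
    rintro _ ⟨u, hu, rfl⟩
    refine ⟨-u, ?_, by simp⟩
    rwa [UnitsModNeg.mk_eq_mk.2 (.inr (neg_neg u).symm)]
  exact ⟨fun h => by simpa using key _ h, key x⟩

@[simp] theorem liftSet_empty : liftSet (∅ : Set (UnitsModNeg p)) = ∅ := by
  ext x; simp [liftSet]

variable [hp : Fact p.Prime]

theorem zero_notMem_liftSet (S : Set (UnitsModNeg p)) : (0 : ZMod p) ∉ liftSet S := by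
  rintro ⟨u, -, h⟩
  exact u.ne_zero h

theorem exists_liftSet_eq {T : Set (ZMod p)} (h0 : (0 : ZMod p) ∉ T)
    (hneg : ∀ x, -x ∈ T ↔ x ∈ T) : ∃ S : Set (UnitsModNeg p), liftSet S = T := by
  refine ⟨{k | ∃ u : (ZMod p)ˣ, (u : UnitsModNeg p) = k ∧ (u : ZMod p) ∈ T}, Set.ext fun x => ?_⟩
  constructor
  · rintro ⟨u, ⟨v, hv, hvT⟩, rfl⟩
    rcases UnitsModNeg.mk_eq_mk.1 hv with rfl | rfl
    · exact hvT
    · rwa [Units.val_neg, hneg]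
  · intro hx
    exact ⟨Units.mk0 x fun h => h0 (h ▸ hx), ⟨_, rfl, hx⟩, rfl⟩

theorem smul_eq_iff_forall_mul_mem_liftSet {S S' : Set (UnitsModNeg p)} {m : (ZMod p)ˣ} :
    (m : UnitsModNeg p) • S = S' ↔ ∀ x : ZMod p, m * x ∈ liftSet S' ↔ x ∈ liftSet S := by
  rw [smul_set_eq_iff_forall_smul_mem_iff]
  constructor
  · intro h x
    by_cases hx : x = 0
    · simp [hx, zero_notMem_liftSet]
    · obtain ⟨u, rfl⟩ : ∃ u : (ZMod p)ˣ, ↑u = x := ⟨Units.mk0 x hx, rfl⟩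
      rw [← Units.val_mul, coe_mem_liftSet, coe_mem_liftSet]
      exact h u
  · intro h k
    obtain ⟨u, rfl⟩ := QuotientGroup.mk_surjective k
    rw [smul_eq_mul, ← QuotientGroup.mk_mul, ← coe_mem_liftSet, ← coe_mem_liftSet, Units.val_mul]
    exact h u

omit hp in
theorem neg_mem_iff_of_inv_eq {G : Type*} [Group G] {S : Set G} (h : S⁻¹ = S) (x : G) :
    x⁻¹ ∈ S ↔ x ∈ S := by
  rw [← Set.mem_inv, h]

/-- The circulant graph with connection set `liftSet S`. -/
def circulantCayley (S : Set (UnitsModNeg p)) : SimpleGraph (Multiplicative (ZMod p)) :=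
  cayleyGraph {g | g.toAdd ∈ liftSet S} (zero_notMem_liftSet S)
    (Set.ext fun _ => neg_mem_liftSet)

theorem circulantCayley_adj {S : Set (UnitsModNeg p)} {x y : Multiplicative (ZMod p)} :
    (circulantCayley S).Adj x y ↔ y.toAdd - x.toAdd ∈ liftSet S := by
  rw [sub_eq_add_neg]
  rfl

theorem range_circulantCayley :
    Set.range (circulantCayley (p := p)) = {Γ | IsCayleyGraph Γ} := by
  ext Γ
  constructor
  · rintro ⟨S, rfl⟩
    exact ⟨_, _, _, rfl⟩
  · rintro ⟨T, h1, hT, rfl⟩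
    obtain ⟨S, hS⟩ := exists_liftSet_eq (p := p) (T := {x | Multiplicative.ofAdd x ∈ T}) h1
      fun x => neg_mem_iff_of_inv_eq hT (Multiplicative.ofAdd x)
    refine ⟨S, ?_⟩
    ext x y
    rw [circulantCayley_adj, hS, sub_eq_add_neg]
    rfl

theorem isoClass_circulantCayley_eq (hodd : Odd p) {S S' : Set (UnitsModNeg p)} :
    isoClass (circulantCayley S) = isoClass (circulantCayley S') ↔
      MulAction.orbitRel (UnitsModNeg p) _ S S' := by
  rw [isoClass_eq, Setoid.comm', MulAction.orbitRel_apply, MulAction.mem_orbit_iff]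
  constructor
  · rintro ⟨e⟩
    obtain ⟨m, hm, h⟩ := exists_multiplier_of_circulant_iso hodd (S := liftSet S)
      (S' := liftSet S') (e := Multiplicative.ofAdd.trans (e.toEquiv.trans Multiplicative.toAdd))
      fun x y => circulantCayley_adj.symm.trans (e.map_rel_iff.trans circulantCayley_adj)
    exact ⟨((Units.mk0 m hm : (ZMod p)ˣ) : UnitsModNeg p),
      smul_eq_iff_forall_mul_mem_liftSet.2 h⟩
  · rintro ⟨k, hk⟩
    obtain ⟨m, rfl⟩ := QuotientGroup.mk_surjective k
    refine ⟨⟨Multiplicative.toAdd.trans (m.mulLeft.trans Multiplicative.ofAdd), ?_⟩⟩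
    intro x y
    rw [circulantCayley_adj, circulantCayley_adj, ← smul_eq_iff_forall_mul_mem_liftSet.1 hk,
      mul_sub]
    rfl

theorem numCirculantGraphs_eq_natCard (hodd : Odd p) : numCirculantGraphs p =
    Nat.card (MulAction.orbitRel.Quotient (UnitsModNeg p) (Set (UnitsModNeg p))) := by
  rw [numCirculantGraphs, numCayleyGraphs, numUpToIso_eq_ncard, ← range_circulantCayley,
    ← Set.range_comp]
  exact ncard_range_eq_natCard_quotient _ _ fun _ _ => isoClass_circulantCayley_eq hodd

theorem numCirculantGraphs_eq (hodd : Odd p) : (numCirculantGraphs p : ℚ) = circulantCount p := by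
  have key := natCard_orbits_set_of_isCyclic (C := UnitsModNeg p)
  rw [← numCirculantGraphs_eq_natCard hodd, UnitsModNeg.natCard hodd] at key
  have key := congrArg (Nat.cast : ℕ → ℚ) key
  have hp1 : (p : ℚ) - 1 ≠ 0 := sub_ne_zero.2 (by exact_mod_cast hp.out.one_lt.ne')
  have h2 : (((p - 1) / 2 : ℕ) : ℚ) = ((p : ℚ) - 1) / 2 := by
    rw [Nat.cast_div (by obtain ⟨n, hn⟩ := hodd; exact ⟨n, by omega⟩) two_ne_zero,
      Nat.cast_pred hp.out.pos, Nat.cast_two]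
  rw [Nat.cast_mul, h2] at key
  simp only [Nat.div_div_eq_div_mul] at key
  push_cast at key
  rw [circulantCount, ← key]
  field_simp

/-! ### Dihedral Cayley graphs as affine orbits -/

/-- The subset of the dihedral group with given rotation and reflection parts. -/
def dihedralSet (T B : Set (ZMod p)) : Set (DihedralGroup p) :=
  {g | match g with
    | r i => i ∈ T
    | sr i => i ∈ B}

omit hp in
@[simp] theorem r_mem_dihedralSet {T B : Set (ZMod p)} {i : ZMod p} :
    r i ∈ dihedralSet T B ↔ i ∈ T := Iff.rfl

omit hp in
@[simp] theorem sr_mem_dihedralSet {T B : Set (ZMod p)} {i : ZMod p} :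
    sr i ∈ dihedralSet T B ↔ i ∈ B := Iff.rfl

/-- The Cayley graph on the dihedral group whose connection set has rotation part `liftSet X.1` and
reflection part `X.2`. -/
def dihedralCayley (X : Set (UnitsModNeg p) × Set (ZMod p)) : SimpleGraph (DihedralGroup p) :=
  cayleyGraph (dihedralSet (liftSet X.1) X.2)
    (by rw [one_def, r_mem_dihedralSet]; exact zero_notMem_liftSet X.1)
    (Set.ext fun g => by rcases g with i | i <;> simp [neg_mem_liftSet])

theorem dihedralCayley_adj {X : Set (UnitsModNeg p) × Set (ZMod p)} {x y : DihedralGroup p} :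
    (dihedralCayley X).Adj x y ↔ y * x⁻¹ ∈ dihedralSet (liftSet X.1) X.2 :=
  Iff.rfl

theorem isDihedralRel_dihedralCayley (X : Set (UnitsModNeg p) × Set (ZMod p)) :
    IsDihedralRel (dihedralCayley X).Adj (liftSet X.1) X.2 where
  rot_rot i j := by simp [dihedralCayley_adj, sub_eq_add_neg]
  refl_refl i j := by
    rw [← neg_mem_liftSet, neg_sub]
    simp [dihedralCayley_adj]
  rot_refl i j := by simp [dihedralCayley_adj, sub_eq_add_neg]
  refl_rot i j := by simp [dihedralCayley_adj]

theorem range_dihedralCayley : Set.range (dihedralCayley (p := p)) = {Γ | IsCayleyGraph Γ} := by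
  ext Γ
  constructor
  · rintro ⟨X, rfl⟩
    exact ⟨_, _, _, rfl⟩
  · rintro ⟨T, h1, hT, rfl⟩
    obtain ⟨S, hS⟩ := exists_liftSet_eq (p := p) (T := {x | r x ∈ T}) h1
      fun x => neg_mem_iff_of_inv_eq hT (r x)
    refine ⟨(S, {x | sr x ∈ T}), ?_⟩
    have : dihedralSet (liftSet S) {x | sr x ∈ T} = T := by
      rw [hS]
      ext (i | i) <;> rfl
    simp only [dihedralCayley, this]

/-- The permutation of the dihedral group induced by an affine bijection. -/
def AffineGroup.toPerm (g : AffineGroup p) : Equiv.Perm (DihedralGroup p) where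
  toFun
    | r i => r (g.lin * i)
    | sr i => sr (g • i)
  invFun
    | r i => r (↑g.lin⁻¹ * i)
    | sr i => sr (g⁻¹ • i)
  left_inv := by
    rintro (i | i)
    · exact congrArg r (Units.inv_mul_cancel_left _ _)
    · exact congrArg sr (inv_smul_smul _ _)
  right_inv := by
    rintro (i | i)
    · exact congrArg r (Units.mul_inv_cancel_left _ _)
    · exact congrArg sr (smul_inv_smul _ _)

theorem isoClass_dihedralCayley_eq (hodd : Odd p) {X Y : Set (UnitsModNeg p) × Set (ZMod p)} :
    isoClass (dihedralCayley X) = isoClass (dihedralCayley Y) ↔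
      MulAction.orbitRel (AffineGroup p) _ X Y := by
  rw [isoClass_eq, Setoid.comm', MulAction.orbitRel_apply, MulAction.mem_orbit_iff]
  have hX := isDihedralRel_dihedralCayley X
  have hY := isDihedralRel_dihedralCayley Y
  constructor
  · rintro ⟨e⟩
    obtain ⟨m, c, hm, hS, hB⟩ := hX.exists_affine_of_iso hodd hY (fun _ => neg_mem_liftSet)
      (fun _ => neg_mem_liftSet) (zero_notMem_liftSet _) (zero_notMem_liftSet _)
      (e := e.toEquiv) fun x y => e.map_rel_iff
    exact ⟨⟨Units.mk0 m hm, c⟩, Prod.ext (smul_eq_iff_forall_mul_mem_liftSet.2 hS)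
      (smul_set_eq_iff_forall_smul_mem_iff.2 hB)⟩
  · rintro ⟨g, rfl⟩
    have hS := smul_eq_iff_forall_mul_mem_liftSet.1 (AffineGroup.smul_set_units g X.1).symm
    have hB := smul_set_eq_iff_forall_smul_mem_iff.1 (rfl : g • X.2 = g • X.2)
    refine ⟨⟨g.toPerm, ?_⟩⟩
    rintro (i | i) (j | j)
    · rw [hX.rot_rot, ← hS, mul_sub]
      exact hY.rot_rot _ _
    · rw [hX.rot_refl, ← hB, AffineGroup.smul_def]
      refine (hY.rot_refl _ _).trans (iff_of_eq (congrArg (· ∈ g • X.2) ?_))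
      rw [AffineGroup.smul_def]
      ring
    · rw [hX.refl_rot, ← hB, AffineGroup.smul_def]
      refine (hY.refl_rot _ _).trans (iff_of_eq (congrArg (· ∈ g • X.2) ?_))
      rw [AffineGroup.smul_def]
      ring
    · rw [hX.refl_refl, ← hS]
      refine (hY.refl_refl _ _).trans (iff_of_eq (congrArg (· ∈ liftSet (g • X.1)) ?_))
      rw [AffineGroup.smul_def, AffineGroup.smul_def]
      ring

theorem numCayleyGraphs_dihedralGroup_eq (hodd : Odd p) :
    (numCayleyGraphs (DihedralGroup p) : ℚ) = dihedralCount p := by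
  rw [← natCard_orbits_affineGroup hodd, numCayleyGraphs, numUpToIso_eq_ncard,
    ← range_dihedralCayley, ← Set.range_comp]
  exact congrArg _
    (ncard_range_eq_natCard_quotient _ _ fun _ _ => isoClass_dihedralCayley_eq hodd)

/-! ### Disconnected graphs and the final count -/

omit hp in
theorem SimpleGraph.Reachable.of_forall_adj {V : Type*} {Γ : SimpleGraph V} {P : V → Prop}
    (h : ∀ x y, Γ.Adj x y → P x → P y) {x y : V} (hxy : Γ.Reachable x y) (hx : P x) : P y := by
  obtain ⟨w⟩ := hxy
  induction w with
  | nil => exact hx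
  | cons hadj _ ih => exact ih (h _ _ hadj hx)

/-- One reflection edge at each rotation joins the cosets, and a nonzero step from `S`, or a
difference of two elements of `B`, reaches all rotations. Otherwise the graph splits along the
cosets or is a perfect matching. -/
theorem IsDihedralRel.not_connected_iff {Γ : SimpleGraph (DihedralGroup p)} {S B : Set (ZMod p)}
    (h : IsDihedralRel Γ.Adj S B) (h0 : (0 : ZMod p) ∉ S) :
    ¬ Γ.Connected ↔ B = ∅ ∨ S = ∅ ∧ ∃ b, B = {b} := by
  constructor
  · intro hc
    by_contra! hne
    obtain ⟨⟨b, hb⟩, h2⟩ := hne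
    have hrs : ∀ i, Γ.Reachable (r i) (sr (i + b)) := fun i =>
      ((h.rot_refl _ _).2 (by simpa using hb)).reachable
    obtain ⟨d, hd, hstep⟩ : ∃ d : ZMod p, d ≠ 0 ∧ ∀ i, Γ.Reachable (r i) (r (i + d)) := by
      rcases S.eq_empty_or_nonempty with hS | ⟨s, hs⟩
      · obtain ⟨b', hb', hne⟩ : ∃ b' ∈ B, b' ≠ b := by
          by_contra! hall
          exact h2 hS b (Set.eq_singleton_iff_unique_mem.2 ⟨hb, hall⟩)
        refine ⟨b - b', sub_ne_zero.2 hne.symm, fun i => (hrs i).trans ?_⟩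
        refine ((h.refl_rot _ _).2 ?_).reachable
        convert hb' using 1
        ring
      · exact ⟨s, fun h => h0 (h ▸ hs), fun i =>
          ((h.rot_rot _ _).2 (by simpa using hs)).reachable⟩
    have hr : ∀ i, Γ.Reachable (r 0) (r i) :=
      ZMod.induction_add_of_ne_zero hd (.refl _) fun i hi => hi.trans (hstep i)
    refine hc (SimpleGraph.connected_iff_exists_forall_reachable _ |>.2 ⟨r 0, ?_⟩)
    rintro (i | i)
    · exact hr i
    · simpa [-r_zero] using (hr (i - b)).trans (hrs (i - b))
  · rintro (rfl | ⟨rfl, b, rfl⟩) hc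
    · have := (hc.preconnected (r 0) (sr 0)).of_forall_adj (P := fun x => ∃ i, x = r i)
        (by rintro (i | i) (j | j) <;> simp [h.rot_refl]) ⟨0, rfl⟩
      simp at this
    · have := (hc.preconnected (r 0) (r 1)).of_forall_adj (P := fun x => x = r 0 ∨ x = sr b)
        (by
          rintro (i | i) (j | j) <;>
            simp +contextual [-r_zero, h.rot_rot, h.refl_refl, h.rot_refl, h.refl_rot,
              sub_eq_iff_eq_add])
        (.inl rfl)
      simp [-r_zero] at this

/-- On an empty reflection part translations do nothing, so the classes are the orbits that count
circulants. The one-element reflection parts form a single affine orbit, the extra 1. -/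
theorem numUpToIso_not_connected (hodd : Odd p) :
    numUpToIso (fun Γ : SimpleGraph (DihedralGroup p) => IsCayleyGraph Γ ∧ ¬ Γ.Connected) =
      numCirculantGraphs p + 1 := by
  have himage : isoClass '' {Γ : SimpleGraph (DihedralGroup p) |
      IsCayleyGraph Γ ∧ ¬ Γ.Connected} = insert (isoClass (dihedralCayley (∅, {0})))
        (Set.range fun S : Set (UnitsModNeg p) => isoClass (dihedralCayley (S, ∅))) := by
    ext c
    constructor
    · rintro ⟨Γ, ⟨hΓ, hc⟩, rfl⟩
      obtain ⟨⟨S, B⟩, rfl⟩ := range_dihedralCayley.ge hΓ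
      rcases ((isDihedralRel_dihedralCayley (S, B)).not_connected_iff (zero_notMem_liftSet _)).1 hc
        with hB | ⟨hS, b, hB⟩
      · obtain rfl : B = ∅ := hB
        exact .inr ⟨S, rfl⟩
      · left
        obtain rfl : B = {b} := hB
        have hS' : S = ∅ := by
          refine Set.eq_empty_of_forall_notMem fun k hk => ?_
          obtain ⟨u, rfl⟩ := QuotientGroup.mk_surjective k
          exact hS.le (coe_mem_liftSet.2 hk)
        rw [isoClass_dihedralCayley_eq hodd, MulAction.orbitRel_apply]
        refine ⟨⟨1, b⟩, Prod.ext ?_ ?_⟩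
        · simp [hS']
        · simp [AffineGroup.smul_def]
    · rintro (rfl | ⟨S, rfl⟩)
      · refine ⟨_, ⟨range_dihedralCayley.le ⟨_, rfl⟩, ?_⟩, rfl⟩
        rw [(isDihedralRel_dihedralCayley _).not_connected_iff (zero_notMem_liftSet _)]
        exact .inr ⟨liftSet_empty, 0, rfl⟩
      · refine ⟨_, ⟨range_dihedralCayley.le ⟨_, rfl⟩, ?_⟩, rfl⟩
        rw [(isDihedralRel_dihedralCayley _).not_connected_iff (zero_notMem_liftSet _)]
        exact .inl rfl
  rw [numUpToIso_eq_ncard, himage, Set.ncard_insert_of_notMem, numCirculantGraphs_eq_natCard hodd]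
  · congr 1
    refine ncard_range_eq_natCard_quotient _ _ fun S S' => ?_
    rw [isoClass_dihedralCayley_eq hodd, MulAction.orbitRel_apply, MulAction.orbitRel_apply]
    constructor
    · rintro ⟨g, hg⟩
      exact ⟨(g.lin : UnitsModNeg p), congrArg Prod.fst hg⟩
    · rintro ⟨k, hk⟩
      obtain ⟨m, rfl⟩ := QuotientGroup.mk_surjective k
      exact ⟨⟨m, 0⟩, Prod.ext hk Set.smul_set_empty⟩
  · rintro ⟨S, hS⟩
    rw [isoClass_dihedralCayley_eq hodd, MulAction.orbitRel_apply] at hS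
    obtain ⟨g, hg⟩ := hS
    have := congrArg Prod.snd hg
    simp at this

end

theorem mainTheorem5 (p : ℕ) (hp : p.Prime) (hodd : Odd p) :
    (numConnectedCayleyGraphs (DihedralGroup p) : ℚ) = dihedralCount p - circulantCount p - 1 ∧
      (numCayleyGraphs (DihedralGroup p) : ℚ) = dihedralCount p ∧
      (numCirculantGraphs p : ℚ) = circulantCount p := by
  have := Fact.mk hp
  have hD := numCayleyGraphs_dihedralGroup_eq hodd
  have hC := numCirculantGraphs_eq hodd
  refine ⟨?_, hD, hC⟩
  have key := numUpToIso_and_add_numUpToIso_and_not (V := DihedralGroup p)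
    (P := fun Γ => IsCayleyGraph Γ) (Q := fun Γ => Γ.Connected)
    fun Γ Δ ⟨e⟩ h => e.connected_iff.1 h
  rw [numUpToIso_not_connected hodd] at key
  have key := congrArg (Nat.cast : ℕ → ℚ) key
  rw [numCayleyGraphs] at hD
  push_cast at key
  rw [numConnectedCayleyGraphs, ← hD, ← hC, ← key]
  ring
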